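/- Let $\mathbb D=\{z\in\mathbb C:|z|<1\}$. For $0<\lambda\le 1$ let $\mathcal U(\lambda)$ be the class of functions $f$ analytic in $\mathbb D$ with $f(0)=0$, $f'(0)=1$, $f(z)\neq 0$ for $0<|z|<1$, and $$\left|\left(\frac{z}{f(z)}\right)^2 f'(z)-1\right|<\lambda\qquad(z\in\mathbb D),$$ where $z/f(z)$ takes the value $1$ at $z=0$. For $F,G$ analytic in $\mathbb D$, write $F\prec G$ if there is a function $\omega$ analytic in $\mathbb D$ with $\omega(0)=0$, $|\omega(z)|<1$ and $F(z)=G(\omega(z))$ for all $z\in\mathbb D$. **Theorem.** The equation $9x^4-3x^3+x^2+2x-1=0$ has exactly one positive root $\lambda_0$, and $\lambda_0=0.400436\ldots$. Let $\lambda_0\le\lambda\le 1$. If $f(z)=z+a_2z^2+a_3z^3+\cdots$ belongs to $\mathcal U(\lambda)$ and satisfies $$\frac{f(z)}{z}\prec\frac{1}{(1+z)(1+\lambda z)}$$ (with $f(z)/z$ equal to $1$ at $z=0$), then $$|a_5|\le 1+\lambda+\lambda^2+\lambda^3+\lambda^4 .$$ The bound is sharp: the function $f_\lambda(z)=\dfrac{z}{(1-z)(1-\lambda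 z)}$ belongs to $\mathcal U(\lambda)$, with $\left(\dfrac{z}{f_\lambda(z)}\right)^2f_\lambda'(z)-1=-\lambda z^2$ for $z\in\mathbb D$, it satisfies the subordination above, and its coefficient of $z^5$ has modulus exactly $1+\lambda+\lambda^2+\lambda^3+\lambda^4$. -/

import Mathlib

/-- The open unit disk of `ℂ`. -/
def unitDisk : Set ℂ := Metric.ball 0 1

/-- The class `𝒜`: functions analytic in the unit disk with `f 0 = 0` and `f' 0 = 1`. -/
structure IsNormalizedAnalytic (f : ℂ → ℂ) : Prop where
  analytic : AnalyticOnNhd ℂ f unitDisk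
  map_zero : f 0 = 0
  deriv_zero : deriv f 0 = 1

/-- The function `z ↦ f z / z`, with its removable singularity at `0` filled in
(for `f 0 = 0` the limit of `f z / z` at `0` is `f' 0`). -/
noncomputable def quotByZ (f : ℂ → ℂ) (z : ℂ) : ℂ :=
  open Classical in if z = 0 then deriv f 0 else f z / z

/-- The expression `(z / f z) ^ 2 * f' z - 1`, where `z / f z` is read as the reciprocal of
`f z / z`, so that it has its limit value at `z = 0`. -/
noncomputable def uExpr (f : ℂ → ℂ) (z : ℂ) : ℂ :=
  ((quotByZ f z)⁻¹) ^ 2 * deriv f z - 1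

/-- The class `𝒰(lam)`. The condition that `f z ≠ 0` off the origin makes `z / f z` meaningful. -/
structure ClassU (lam : ℝ) (f : ℂ → ℂ) : Prop where
  normalized : IsNormalizedAnalytic f
  ne_zero : ∀ z ∈ unitDisk, z ≠ 0 → f z ≠ 0
  bound : ∀ z ∈ unitDisk, ‖uExpr f z‖ < lam

/-- Subordination `F ≺ G` in the unit disk, for `F` and `G` analytic there: `F = G ∘ ω` with `ω`
analytic in the disk, `ω 0 = 0` and `|ω| < 1`. -/
def Subordinate (F G : ℂ → ℂ) : Prop :=
  ∃ ω : ℂ → ℂ, AnalyticOnNhd ℂ ω unitDisk ∧ ω 0 = 0 ∧ (∀ z ∈ unitDisk, ‖ω z‖ < 1) ∧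
    ∀ z ∈ unitDisk, F z = G (ω z)

/-- The `n`-th Taylor coefficient of `f` at the origin. -/
noncomputable def taylorCoeff (f : ℂ → ℂ) (n : ℕ) : ℂ :=
  iteratedDeriv n f 0 / (n.factorial : ℂ)

/-- The superordinate function `1 / ((1 + z) (1 + lam z))`. -/
noncomputable def majorant (lam : ℝ) (z : ℂ) : ℂ :=
  1 / ((1 + z) * (1 + (lam : ℂ) * z))

/-- The function `z / ((1 - z) (1 - lam z))`. -/
noncomputable def extremalFn (lam : ℝ) (z : ℂ) : ℂ :=
  z / ((1 - z) * (1 - (lam : ℂ) * z))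

/-! Write `f z / z = 1 / ((1 - u) (1 - l u))` with `u = -ω = z ψ` and `|ψ| ≤ 1`, and put `Q = 1 / (1
- u) = 1 + q₁ z + q₂ z² + ⋯`. Since `F (l + (1 - l) Q) = z Q²` for the series `F` of `f`, the fifth
coefficient is `(1 + l) q₄ + l² E`, where `E` involves only `q₁, q₂, q₃`. It suffices to show `|q₄|
≤ 1` and `|E| ≤ 1 + l + l²`, because `(1 + l) + l² (1 + l + l²)` is the required bound.

The first estimate follows from `Re Q ≥ 1/2` (`norm_taylorCoeff_four_le_one`). For the second, two
Schur steps express `q₁, q₂, q₃` through free parameters `a, b, w` in the closed disk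
(`coeff_geom_of_schur`). Eliminating `w` by the triangle inequality and rotating `a` onto the
positive axis leaves `X = |a|²` and one complex variable `v` (`norm_schurCombination_le`,
`norm_rotated_le`). Squaring reduces the claim to nonnegativity of a quadratic form in `X` and `1 -
X` whose coefficients depend on `s = Re v` and `Y = |v|²` (`coeffForm_nonneg`).

The estimates hold for all `l ≥ 2/5`; the quartic enters the bound only through `lam₀ ≥ 2/5`.
Equality occurs for `ψ = 1`, when every coefficient of `Q` is `1`. -/

/-! ### Real inequalities for the extremal problem -/

/-- A binary quadratic form whose coefficients dominate those of a perfect square is nonnegative. -/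
lemma quadForm_nonneg_of_sq_le {c₁ c₂ c₃ u v K r X t : ℝ} (hX : 0 ≤ X) (ht : 0 ≤ t)
    (hr : r ^ 2 ≤ K) (h₁ : 2 * K * u ^ 2 ≤ c₁) (h₃ : 8 * v ^ 2 ≤ c₃)
    (h₂ : 0 ≤ c₂ + 8 * r * u * v) :
    0 ≤ c₁ * X ^ 2 + c₂ * (X * t) + c₃ * t ^ 2 := by
  have h₁' : 2 * (r * u) ^ 2 ≤ c₁ := by nlinarith [sq_nonneg u]
  have hXt : 0 ≤ X * t := mul_nonneg hX ht
  -- The form dominates `2 (r u X - 2 v t)²`, whose mixed coefficient is `-8 r u v`.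
  nlinarith [mul_le_mul_of_nonneg_right h₁' (sq_nonneg X),
    mul_le_mul_of_nonneg_right h₃ (sq_nonneg t), mul_nonneg h₂ hXt,
    sq_nonneg (r * u * X - 2 * v * t)]

/-- The mixed coefficient of the form in `coeffForm_nonneg`. -/
noncomputable def mixedCoeff (l s Y : ℝ) : ℝ :=
  6 * (l + l ^ 2) ^ 2 + 2 * (l + l ^ 2) - 4 * (1 + l + l ^ 2) * s ^ 2 +
    Y * (3 * l ^ 2 - 6 * l - 5 + 12 * (1 + l) * s)

/-- Once `s²` is replaced by `Y`, the remaining terms in `s` are nonnegative multiples of `-s`. What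
is left is a constant of at least `3 + 14/5` against a loss of at most `3 + l`. -/
lemma mixedCoeff_add_nonneg_of_nonpos {l s Y : ℝ} (hl : 2 / 5 ≤ l) (hl1 : l ≤ 1)
    (hsY : s ^ 2 ≤ Y) (hY : Y ≤ 1) (hs : s ≤ 0) :
    0 ≤ mixedCoeff l s Y +
      8 * (1 + l / 2) * (3 * (1 + l) / 4 - 2 * s) * (Y + (l + l ^ 2) / 2) := by
  have hY0 : 0 ≤ Y := (sq_nonneg s).trans hsY
  have hl2 : 4 / 25 ≤ l ^ 2 := by nlinarith
  have hk : 14 / 25 ≤ l + l ^ 2 := by linarith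
  have hk2 : 3 ≤ 6 * (l + l ^ 2) ^ 2 + 2 * (l + l ^ 2) := by nlinarith
  have e₁ : 0 ≤ (1 + l + l ^ 2) * (Y - s ^ 2) := mul_nonneg (by positivity) (by linarith)
  have e₂ : 0 ≤ (1 - l) * (Y * -s) := mul_nonneg (by linarith) (mul_nonneg hY0 (by linarith))
  have e₃ : 0 ≤ (8 + 4 * l) * (l + l ^ 2) * -s := mul_nonneg (by positivity) (by linarith)
  have e₄ : 0 ≤ (3 + l) * (1 - Y) := mul_nonneg (by linarith) (by linarith)
  have e₅ : 0 ≤ l ^ 2 * Y := by positivity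
  have e₆ : 5 * (14 / 25) ≤ (3 + 3 / 2 * l) * (1 + l) * (l + l ^ 2) :=
    mul_le_mul (by nlinarith) hk (by norm_num) (by positivity)
  unfold mixedCoeff
  linarith

/-- The only dangerous term is `-4 (1 + l + l²) s²`; the upper limit on `s` gives `s² ≤ (l + l²) /
2`, which is enough to absorb it. -/
lemma mixedCoeff_add_nonneg_of_le {l s Y : ℝ} (hl : 2 / 5 ≤ l)
    (hY0 : 0 ≤ Y) (hs : 0 ≤ s) (hs' : s ≤ 3 * (1 + l) / 8) :
    0 ≤ mixedCoeff l s Y + 8 * (1 + l / 2) * (3 * (1 + l) / 4 - 2 * s) *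
      (Y + ((l + l ^ 2) - 3 * (1 + l) / 4 * s) / 2) := by
  have hu : 3 * (1 + l) / 4 * s ≤ l + l ^ 2 := by nlinarith
  have e₁ : 0 ≤ (4 + 2 * l) * (3 * (1 + l) / 4 - 2 * s) * (l + l ^ 2 - 3 * (1 + l) / 4 * s) :=
    mul_nonneg (mul_nonneg (by linarith) (by linarith)) (by linarith)
  have e₂ : 0 ≤ Y * (1 + 3 * l + 6 * l ^ 2 - 4 * (1 - l) * s) :=
    mul_nonneg hY0 (by nlinarith)
  have e₃ : 4 * (1 + l + l ^ 2) * s ^ 2 ≤ 6 * (l + l ^ 2) ^ 2 + 2 * (l + l ^ 2) := by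
    have h : s ^ 2 ≤ (3 * (1 + l) / 8) ^ 2 := by gcongr
    have h' : s ^ 2 ≤ (l + l ^ 2) / 2 := by nlinarith
    have := mul_le_mul_of_nonneg_left h' (by positivity : 0 ≤ 1 + l + l ^ 2)
    linarith [sq_nonneg (l + l ^ 2)]
  unfold mixedCoeff
  linarith

lemma mixedCoeff_nonneg_of_ge {l s Y : ℝ} (hl : 2 / 5 ≤ l) (hl1 : l ≤ 1)
    (hsY : s ^ 2 ≤ Y) (hs : 3 * (1 + l) / 8 ≤ s) : 0 ≤ mixedCoeff l s Y := by
  have hl2 : 4 / 25 ≤ l ^ 2 := by nlinarith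
  have hk2 : 3 ≤ 6 * (l + l ^ 2) ^ 2 + 2 * (l + l ^ 2) := by nlinarith
  have e₁ : 0 ≤ 3 * l ^ 2 - 6 * l - 5 + 12 * (1 + l) * s := by
    nlinarith [mul_le_mul_of_nonneg_left hs (by linarith : 0 ≤ 1 + l)]
  have e₂ := mul_nonneg (sub_nonneg.2 hsY) e₁
  -- The cubic `12 s³ - 10 s²` has its minimum over `s ≥ 0` at `s = 5/9`, with value `-250/243 >
  -- -11/10`.
  have e₃ : 0 ≤ 11 / 10 - s ^ 2 * (10 - 12 * s) := by
    linarith [mul_nonneg (sq_nonneg (s - 5 / 9)) (by linarith : 0 ≤ 12 * s + 10 / 3)]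
  have e₄ := mul_nonneg (by linarith : 0 ≤ 1 + l) e₃
  have e₅ : 0 ≤ (1 + l) * (1 - l) * s ^ 2 :=
    mul_nonneg (mul_nonneg (by linarith) (by linarith)) (sq_nonneg s)
  unfold mixedCoeff
  linarith

/-- Comparison with a perfect square whose first root is `u = 3 (1 + l) / 4 - 2 s`. The cases follow
the sign of `s`, which decides the second root `v`, and the sign of `u`: for `u ≤ 0` the square is
of no help, but then all three coefficients are nonnegative. -/
lemma coeffForm_nonneg {l s Y X t : ℝ} (hl : 2 / 5 ≤ l) (hl1 : l ≤ 1) (hsY : s ^ 2 ≤ Y)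
    (hY : Y ≤ 1) (hX : 0 ≤ X) (ht : 0 ≤ t) :
    0 ≤ 2 * (1 + l + l ^ 2) * (2 * (l + l ^ 2) + 4 * s ^ 2 - 3 * (1 + l) * s) * X ^ 2 +
      mixedCoeff l s Y * (X * t) +
      (4 * (l + l ^ 2) ^ 2 + 8 * (l + l ^ 2) * Y + 8 * Y ^ 2 - 6 * (1 + l) * s * Y) * t ^ 2 := by
  have hY0 : 0 ≤ Y := (sq_nonneg s).trans hsY
  -- A polynomial lower bound for `√(1 + l + l²)`.
  have hr : (1 + l / 2) ^ 2 ≤ 1 + l + l ^ 2 := by nlinarith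
  -- The terms in `s` agree on both sides; what remains is `9 (1 + l) ≤ 32 l`, that is `l ≥ 9/23`,
  -- which `2/5` satisfies.
  have h₁ : 2 * (1 + l + l ^ 2) * (3 * (1 + l) / 4 - 2 * s) ^ 2 ≤
      2 * (1 + l + l ^ 2) * (2 * (l + l ^ 2) + 4 * s ^ 2 - 3 * (1 + l) * s) :=
    mul_le_mul_of_nonneg_left (by nlinarith) (by positivity)
  have hs1 : s ≤ 1 := by nlinarith
  rcases le_total s 0 with hs | hs
  · refine quadForm_nonneg_of_sq_le hX ht hr h₁ ?_
      (mixedCoeff_add_nonneg_of_nonpos hl hl1 hsY hY hs)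
    linarith [mul_nonneg (mul_nonneg (by linarith : 0 ≤ 1 + l) (neg_nonneg.2 hs)) hY0,
      sq_nonneg (l + l ^ 2)]
  have hu0 : 0 ≤ 3 * (1 + l) / 4 * s := mul_nonneg (by linarith) hs
  have hu : 3 * (1 + l) / 4 * s ≤ 2 * (l + l ^ 2) := by nlinarith
  -- The second root is chosen to match the terms in `Y²` and `Y` exactly, leaving only a comparison
  -- of constant terms.
  have h₃ : 8 * (Y + ((l + l ^ 2) - 3 * (1 + l) / 4 * s) / 2) ^ 2 ≤
      4 * (l + l ^ 2) ^ 2 + 8 * (l + l ^ 2) * Y + 8 * Y ^ 2 - 6 * (1 + l) * s * Y := by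
    linarith [mul_nonneg hu0 (sub_nonneg.2 hu), sq_nonneg (l + l ^ 2)]
  rcases le_total s (3 * (1 + l) / 8) with hs' | hs'
  · exact quadForm_nonneg_of_sq_le hX ht hr h₁ h₃ (mixedCoeff_add_nonneg_of_le hl hY0 hs hs')
  · have h₂' := mul_nonneg (mixedCoeff_nonneg_of_ge hl hl1 hsY hs') (mul_nonneg hX ht)
    have h₃' := mul_nonneg ((by positivity : (0 : ℝ) ≤
      8 * (Y + ((l + l ^ 2) - 3 * (1 + l) / 4 * s) / 2) ^ 2).trans h₃) (sq_nonneg t)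
    have h₁' := mul_nonneg ((by positivity : (0 : ℝ) ≤ 2 * (1 + l + l ^ 2) *
      (3 * (1 + l) / 4 - 2 * s) ^ 2).trans h₁) (sq_nonneg X)
    linarith

/-- The extremal problem for the second coefficient parameter, after rotation. -/
lemma norm_rotated_le {l X : ℝ} {v : ℂ} (hl : 2 / 5 ≤ l) (hl1 : l ≤ 1) (hX : 0 ≤ X) (hX1 : X ≤ 1)
    (hv : ‖v‖ ≤ 1) :
    ‖((1 + l + l ^ 2) * X ^ 2 + 3 * (1 + l) * X * (1 - X) * v +
      (1 - X) * (1 - 3 * X) * v ^ 2 : ℂ)‖ + (1 - X ^ 2) * (1 - ‖v‖ ^ 2) ≤ 1 + l + l ^ 2 := by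
  have hY : ‖v‖ ^ 2 = v.re ^ 2 + v.im ^ 2 := by
    rw [← Complex.normSq_eq_norm_sq, Complex.normSq_apply]; ring
  have hY1 : ‖v‖ ^ 2 ≤ 1 := by nlinarith [norm_nonneg v]
  set Y := ‖v‖ ^ 2 with hYdef
  have hY0 : 0 ≤ Y := sq_nonneg _
  have hsY : v.re ^ 2 ≤ Y := by nlinarith [sq_nonneg v.im]
  have hX2 : X ^ 2 ≤ 1 := by nlinarith
  have hR : 0 ≤ 1 + l + l ^ 2 - (1 - X ^ 2) * (1 - Y) := by
    nlinarith [mul_nonneg (sub_nonneg.2 hX2) hY0, sq_nonneg X]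
  rw [← le_sub_iff_add_le]
  refine abs_le_of_sq_le_sq' ?_ hR |>.2
  rw [← Complex.normSq_eq_norm_sq, Complex.normSq_apply, ← sub_nonneg]
  have key := coeffForm_nonneg (t := 1 - X) hl hl1 hsY hY1 hX (by linarith)
  -- The difference of the squares is exactly `X (1 - X)` times the quadratic form plus the multiple
  -- of `(1 - X)⁴` in `h₂`.
  have h₁ := mul_nonneg (mul_nonneg key hX) (by linarith : 0 ≤ 1 - X)
  have h₂ : 0 ≤ ((l + l ^ 2) ^ 2 + 2 * (l + l ^ 2) * Y) * (1 - X) ^ 4 := by positivity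
  have him : v.im ^ 2 = Y - v.re ^ 2 := by linarith
  have hre : ((1 + l + l ^ 2) * X ^ 2 + 3 * (1 + l) * X * (1 - X) * v +
      (1 - X) * (1 - 3 * X) * v ^ 2 : ℂ).re = (1 + l + l ^ 2) * X ^ 2 +
      3 * (1 + l) * X * (1 - X) * v.re + (1 - X) * (1 - 3 * X) * (v.re ^ 2 - v.im ^ 2) := by
    simp [pow_two]
  have him' : ((1 + l + l ^ 2) * X ^ 2 + 3 * (1 + l) * X * (1 - X) * v +
      (1 - X) * (1 - 3 * X) * v ^ 2 : ℂ).im =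
      (3 * (1 + l) * X * (1 - X) + 2 * (1 - X) * (1 - 3 * X) * v.re) * v.im := by
    simp [pow_two]; ring
  rw [hre, him']
  have : ∀ A B C : ℝ, A * A + (B * C) * (B * C) = A ^ 2 + B ^ 2 * C ^ 2 := by intros; ring
  rw [this, him]
  refine (add_nonneg h₁ h₂).trans (le_of_eq ?_)
  unfold mixedCoeff
  ring

/-- The bound for the nonlinear part of the fifth coefficient in terms of Schur parameters. -/
lemma norm_schurCombination_le {l : ℝ} {a b w : ℂ} (hl : 2 / 5 ≤ l) (hl1 : l ≤ 1)
    (ha : ‖a‖ ≤ 1) (hb : ‖b‖ ≤ 1) (hw : ‖w‖ ≤ 1) :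
    ‖((1 + l + l ^ 2) * a ^ 4 + 3 * (1 + l) * a ^ 2 * ((1 - ‖a‖ ^ 2) * b) +
      (1 - ‖a‖ ^ 2) * (1 - 3 * ‖a‖ ^ 2) * b ^ 2 +
      2 * a * (1 - ‖a‖ ^ 2) * (1 - ‖b‖ ^ 2) * w : ℂ)‖ ≤ 1 + l + l ^ 2 := by
  obtain ⟨e, he, hae⟩ : ∃ e : ℂ, ‖e‖ = 1 ∧ (‖a‖ : ℂ) * e = a :=
    ⟨Complex.exp (a.arg * Complex.I), Complex.norm_exp_ofReal_mul_I _,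
      Complex.norm_mul_exp_arg_mul_I a⟩
  have hee : (starRingEnd ℂ) e * e = 1 := by
    rw [mul_comm, Complex.mul_conj', he]; simp
  -- The combination is homogeneous when `a` has weight 1 and `b` weight 2, so `a = |a| e`, `b = e²
  -- v` pulls out the unimodular factor `e⁴`.
  set v : ℂ := (starRingEnd ℂ) e ^ 2 * b with hv
  have hvb : ‖v‖ = ‖b‖ := by simp [hv, he]
  have hbv : b = e ^ 2 * v := by
    rw [hv, ← mul_assoc, ← mul_pow, mul_comm e, hee]; simp
  have hx2 : ‖a‖ ^ 2 ≤ 1 := by nlinarith [norm_nonneg a]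
  have hb2 : ‖b‖ ^ 2 ≤ 1 := by nlinarith [norm_nonneg b]
  have key := norm_rotated_le (v := v) hl hl1 (sq_nonneg ‖a‖) hx2 (hvb ▸ hb)
  have h₁ : ((1 + l + l ^ 2) * a ^ 4 + 3 * (1 + l) * a ^ 2 * ((1 - ‖a‖ ^ 2) * b) +
      (1 - ‖a‖ ^ 2) * (1 - 3 * ‖a‖ ^ 2) * b ^ 2 : ℂ) = e ^ 4 *
      ((1 + l + l ^ 2) * ((‖a‖ ^ 2 : ℝ) : ℂ) ^ 2 +
        3 * (1 + l) * ((‖a‖ ^ 2 : ℝ) : ℂ) * (1 - ((‖a‖ ^ 2 : ℝ) : ℂ)) * v +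
      (1 - ((‖a‖ ^ 2 : ℝ) : ℂ)) * (1 - 3 * ((‖a‖ ^ 2 : ℝ) : ℂ)) * v ^ 2) := by
    have h4 : a ^ 4 = ‖a‖ ^ 4 * e ^ 4 := by rw [← mul_pow, hae]
    have h2 : a ^ 2 = ‖a‖ ^ 2 * e ^ 2 := by rw [← mul_pow, hae]
    rw [h4, h2, hbv]
    push_cast
    ring
  have h₂ : ‖(2 * a * (1 - ‖a‖ ^ 2) * (1 - ‖b‖ ^ 2) * w : ℂ)‖ ≤
      (1 - (‖a‖ ^ 2) ^ 2) * (1 - ‖v‖ ^ 2) := by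
    have e₁ : ‖(1 - ‖a‖ ^ 2 : ℂ)‖ = 1 - ‖a‖ ^ 2 := by
      rw [← Complex.ofReal_pow, ← Complex.ofReal_one, ← Complex.ofReal_sub, Complex.norm_real,
        Real.norm_of_nonneg (by linarith)]
    have e₂ : ‖(1 - ‖b‖ ^ 2 : ℂ)‖ = 1 - ‖b‖ ^ 2 := by
      rw [← Complex.ofReal_pow, ← Complex.ofReal_one, ← Complex.ofReal_sub, Complex.norm_real,
        Real.norm_of_nonneg (by linarith)]
    rw [norm_mul, norm_mul, norm_mul, norm_mul, e₁, e₂, hvb, Complex.norm_ofNat]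
    have h0 : 0 ≤ (1 - ‖a‖ ^ 2) * (1 - ‖b‖ ^ 2) := mul_nonneg (by linarith) (by linarith)
    calc 2 * ‖a‖ * (1 - ‖a‖ ^ 2) * (1 - ‖b‖ ^ 2) * ‖w‖
        = (1 - ‖a‖ ^ 2) * (1 - ‖b‖ ^ 2) * (2 * ‖a‖ * ‖w‖) := by ring
      -- `2 |a| ≤ 1 + |a|²` removes the odd power of `|a|`, so that only `X = |a|²` remains.
      _ ≤ (1 - ‖a‖ ^ 2) * (1 - ‖b‖ ^ 2) * (1 + ‖a‖ ^ 2) := by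
          gcongr
          nlinarith [norm_nonneg a, sq_nonneg (1 - ‖a‖)]
      _ = _ := by ring
  refine (norm_add_le _ _).trans ?_
  rw [h₁, norm_mul, norm_pow, he, one_pow, one_mul]
  exact (add_le_add_right h₂ _).trans key

/-! ### Taylor series at the origin -/

lemma unitDisk_mem_nhds_zero : unitDisk ∈ nhds (0 : ℂ) := Metric.ball_mem_nhds 0 one_pos

lemma zero_mem_unitDisk : (0 : ℂ) ∈ unitDisk := Metric.mem_ball_self one_pos

lemma mem_unitDisk {z : ℂ} : z ∈ unitDisk ↔ ‖z‖ < 1 := mem_ball_zero_iff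

/-- The Taylor series of `f` at the origin, as a formal power series. -/
noncomputable def taylorSeriesAtZero (f : ℂ → ℂ) : PowerSeries ℂ := PowerSeries.mk (taylorCoeff f)

lemma coeff_taylorSeriesAtZero (f : ℂ → ℂ) (n : ℕ) :
    PowerSeries.coeff n (taylorSeriesAtZero f) = taylorCoeff f n := PowerSeries.coeff_mk _ _

lemma taylorSeriesAtZero_congr {f g : ℂ → ℂ} (h : f =ᶠ[nhds 0] g) :
    taylorSeriesAtZero f = taylorSeriesAtZero g := by
  ext n
  simp only [coeff_taylorSeriesAtZero, taylorCoeff, h.iteratedDeriv_eq n]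

lemma taylorSeriesAtZero_congr_on {f g : ℂ → ℂ} (h : ∀ z ∈ unitDisk, f z = g z) :
    taylorSeriesAtZero f = taylorSeriesAtZero g :=
  taylorSeriesAtZero_congr (Filter.eventually_of_mem unitDisk_mem_nhds_zero h)

lemma coeff_mul_eq_sum_range (p q : PowerSeries ℂ) (n : ℕ) :
    PowerSeries.coeff n (p * q) =
      ∑ i ∈ Finset.range (n + 1), PowerSeries.coeff i p * PowerSeries.coeff (n - i) q := by
  rw [PowerSeries.coeff_mul, Finset.Nat.sum_antidiagonal_eq_sum_range_succ_mk]

lemma taylorSeriesAtZero_mul {f g : ℂ → ℂ} (hf : AnalyticAt ℂ f 0) (hg : AnalyticAt ℂ g 0) :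
    taylorSeriesAtZero (fun z => f z * g z) = taylorSeriesAtZero f * taylorSeriesAtZero g := by
  ext n
  rw [coeff_mul_eq_sum_range]
  simp only [coeff_taylorSeriesAtZero, taylorCoeff]
  rw [show (fun z => f z * g z) = f * g from rfl, iteratedDeriv_mul hf.contDiffAt hg.contDiffAt,
    Finset.sum_div]
  refine Finset.sum_congr rfl fun i hi => ?_
  have hi' : i ≤ n := Nat.lt_succ_iff.1 (Finset.mem_range.1 hi)
  rw [Nat.cast_choose ℂ hi']
  have h₁ : (n.factorial : ℂ) ≠ 0 := by exact_mod_cast n.factorial_ne_zero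
  field_simp

lemma taylorSeriesAtZero_add {f g : ℂ → ℂ} (hf : AnalyticAt ℂ f 0) (hg : AnalyticAt ℂ g 0) :
    taylorSeriesAtZero (fun z => f z + g z) = taylorSeriesAtZero f + taylorSeriesAtZero g := by
  ext n
  simp only [map_add, coeff_taylorSeriesAtZero, taylorCoeff]
  rw [show (fun z => f z + g z) = f + g from rfl, iteratedDeriv_add hf.contDiffAt hg.contDiffAt,
    add_div]

lemma taylorSeriesAtZero_const (c : ℂ) :
    taylorSeriesAtZero (fun _ => c) = PowerSeries.C c := by
  ext n
  rw [coeff_taylorSeriesAtZero, taylorCoeff, iteratedDeriv_const, PowerSeries.coeff_C]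
  split_ifs with h <;> simp [h]

lemma taylorSeriesAtZero_id : taylorSeriesAtZero (fun z => z) = PowerSeries.X := by
  ext n
  rw [coeff_taylorSeriesAtZero, taylorCoeff, PowerSeries.coeff_X]
  rcases n with _ | _ | n
  · simp
  · simp
  · simp [iteratedDeriv_succ', iteratedDeriv_const]

lemma taylorSeriesAtZero_const_mul (c : ℂ) {f : ℂ → ℂ} (hf : AnalyticAt ℂ f 0) :
    taylorSeriesAtZero (fun z => c * f z) = PowerSeries.C c * taylorSeriesAtZero f := by
  rw [taylorSeriesAtZero_mul analyticAt_const hf, taylorSeriesAtZero_const]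

lemma taylorSeriesAtZero_id_mul {f : ℂ → ℂ} (hf : AnalyticAt ℂ f 0) :
    taylorSeriesAtZero (fun z => z * f z) = PowerSeries.X * taylorSeriesAtZero f := by
  rw [taylorSeriesAtZero_mul (f := fun z => z) analyticAt_id hf, taylorSeriesAtZero_id]

lemma coeff_zero_taylorSeriesAtZero (f : ℂ → ℂ) :
    PowerSeries.coeff 0 (taylorSeriesAtZero f) = f 0 := by
  simp [coeff_taylorSeriesAtZero, taylorCoeff]

lemma taylorCoeff_comp_const_mul {f : ℂ → ℂ} (hf : AnalyticOnNhd ℂ f unitDisk) {c : ℂ}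
    (hc : ‖c‖ = 1) (n : ℕ) : taylorCoeff (fun z => f (c * z)) n = c ^ n * taylorCoeff f n := by
  have hopen : IsOpen unitDisk := Metric.isOpen_ball
  have hmaps : Set.MapsTo (c * ·) unitDisk unitDisk := fun z hz => by
    rw [mem_unitDisk] at hz ⊢; simpa [hc] using hz
  have h := iteratedDerivWithin_comp_const_smul (n := n) zero_mem_unitDisk hopen.uniqueDiffOn
    (hf.contDiffOn hopen.uniqueDiffOn) c hmaps
  rw [iteratedDerivWithin_of_isOpen hopen zero_mem_unitDisk, mul_zero,
    iteratedDerivWithin_of_isOpen hopen zero_mem_unitDisk] at h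
  rw [taylorCoeff, h, taylorCoeff, smul_eq_mul, mul_div_assoc]

/-- Taylor coefficients of a function bounded by one in the disk are bounded by one. -/
lemma norm_taylorCoeff_le_one {f : ℂ → ℂ} (hf : AnalyticOnNhd ℂ f unitDisk)
    (hb : ∀ z ∈ unitDisk, ‖f z‖ ≤ 1) (n : ℕ) : ‖taylorCoeff f n‖ ≤ 1 := by
  -- Cauchy's estimate needs a closed disk inside the domain, hence radii `r < 1` and the limit `r →
  -- 1`.
  have hr : ∀ r : ℝ, 0 < r → r < 1 → ‖taylorCoeff f n‖ * r ^ n ≤ 1 := by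
    intro r h0 h1
    have hsub : Metric.closedBall (0 : ℂ) r ⊆ unitDisk := Metric.closedBall_subset_ball h1
    have hd : DiffContOnCl ℂ f (Metric.ball 0 r) :=
      DifferentiableOn.diffContOnCl_ball (hf.differentiableOn) hsub
    have := Complex.norm_iteratedDeriv_le_of_forall_mem_sphere_norm_le n h0 hd
      (C := 1) (fun z hz => hb z (hsub (Metric.sphere_subset_closedBall hz)))
    rw [taylorCoeff, norm_div, Complex.norm_natCast, div_mul_eq_mul_div, div_le_one (by positivity)]
    rwa [mul_one, le_div_iff₀ (by positivity)] at this
  have hlim : Filter.Tendsto (fun r : ℝ => ‖taylorCoeff f n‖ * r ^ n) (nhdsWithin 1 (Set.Iio 1))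
      (nhds (‖taylorCoeff f n‖ * 1 ^ n)) :=
    ((continuous_const.mul (continuous_pow n)).tendsto 1).mono_left nhdsWithin_le_nhds
  rw [one_pow, mul_one] at hlim
  refine le_of_tendsto hlim ?_
  filter_upwards [Ioo_mem_nhdsLT (zero_lt_one' ℝ)] with r hr'
  exact hr r hr'.1 hr'.2

/-! ### The Schur algorithm -/

lemma analyticOnNhd_unitDisk_iff {f : ℂ → ℂ} :
    AnalyticOnNhd ℂ f unitDisk ↔ DifferentiableOn ℂ f unitDisk :=
  Complex.analyticOnNhd_iff_differentiableOn Metric.isOpen_ball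

/-- Division by `z` of a function bounded by one that vanishes at the origin. -/
lemma exists_eq_mul_of_map_zero {f : ℂ → ℂ} (hf : AnalyticOnNhd ℂ f unitDisk) (h0 : f 0 = 0)
    (hb : ∀ z ∈ unitDisk, ‖f z‖ ≤ 1) :
    ∃ g : ℂ → ℂ, AnalyticOnNhd ℂ g unitDisk ∧ (∀ z ∈ unitDisk, ‖g z‖ ≤ 1) ∧
      ∀ z, f z = z * g z := by
  refine ⟨dslope f 0, ?_, fun z hz => ?_, fun z => ?_⟩
  · rw [analyticOnNhd_unitDisk_iff, Complex.differentiableOn_dslope unitDisk_mem_nhds_zero]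
    exact hf.differentiableOn
  · have := Complex.norm_dslope_le_div_of_mapsTo_ball (f := f) (c := 0) (z := z) (R₁ := 1) (R₂ := 1)
      hf.differentiableOn (fun w hw => by simpa [h0] using hb w hw) hz
    simpa using this
  · have := sub_smul_dslope f 0 z
    simpa [h0] using this.symm

/-- One step of the Schur algorithm. -/
lemma exists_schur_step {f : ℂ → ℂ} (hf : AnalyticOnNhd ℂ f unitDisk)
    (hb : ∀ z ∈ unitDisk, ‖f z‖ ≤ 1) :
    ∃ g : ℂ → ℂ, AnalyticOnNhd ℂ g unitDisk ∧ (∀ z ∈ unitDisk, ‖g z‖ ≤ 1) ∧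
      ∀ z ∈ unitDisk, f z * (1 + (starRingEnd ℂ) (f 0) * (z * g z)) = f 0 + z * g z := by
  have h0 := hb 0 zero_mem_unitDisk
  -- If `|f 0| = 1`, the maximum principle makes `f` constant and `g = 0` serves; otherwise a disk
  -- automorphism sends `f 0` to `0` and the result is divided by `z`.
  rcases h0.eq_or_lt with h1 | h1
  · have hmax : IsMaxOn (norm ∘ f) unitDisk 0 := fun z hz => by
      simpa [h1] using hb z hz
    have hconst := Complex.eqOn_of_isPreconnected_of_isMaxOn_norm
      (convex_ball (0 : ℂ) 1).isPreconnected Metric.isOpen_ball hf.differentiableOn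
      zero_mem_unitDisk hmax
    exact ⟨fun _ => 0, analyticOnNhd_const, by simp, fun z hz => by simpa using hconst hz⟩
  set a := f 0 with ha
  have hne : ∀ z ∈ unitDisk, 1 - (starRingEnd ℂ) a * f z ≠ 0 := fun z hz h => by
    have h2 : ‖(starRingEnd ℂ) a * f z‖ = 1 := by rw [← sub_eq_zero.1 h]; simp
    rw [norm_mul, RCLike.norm_conj] at h2
    nlinarith [hb z hz, norm_nonneg (f z), norm_nonneg a]
  obtain ⟨g, hg, hgb, hgz⟩ := exists_eq_mul_of_map_zero
    (f := fun z => (f z - a) / (1 - (starRingEnd ℂ) a * f z))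
    (fun z hz => ((hf z hz).sub analyticAt_const).div
      (analyticAt_const.sub (analyticAt_const.mul (hf z hz))) (hne z hz))
    (by simp [ha]) (fun z hz => by
      rw [norm_div, div_le_one (norm_pos_iff.2 (hne z hz))]
      refine abs_le_of_sq_le_sq' ?_ (norm_nonneg _) |>.2
      have hz1 : Complex.normSq (f z) ≤ 1 := by
        rw [Complex.normSq_eq_norm_sq]; nlinarith [hb z hz, norm_nonneg (f z)]
      have ha1 : Complex.normSq a ≤ 1 := by
        rw [Complex.normSq_eq_norm_sq]; nlinarith [norm_nonneg a]
      rw [← Complex.normSq_eq_norm_sq, ← Complex.normSq_eq_norm_sq]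
      rw [Complex.normSq_apply] at hz1 ha1 ⊢
      rw [Complex.normSq_apply]
      simp only [Complex.sub_re, Complex.sub_im, Complex.one_re, Complex.one_im, Complex.mul_re,
        Complex.mul_im, Complex.conj_re, Complex.conj_im]
      linarith [mul_nonneg (sub_nonneg.2 hz1) (sub_nonneg.2 ha1)])
  refine ⟨g, hg, hgb, fun z hz => ?_⟩
  have h := hgz z
  rw [div_eq_iff (hne z hz)] at h
  linear_combination h

/-! ### Coefficients of functions with real part at least one half -/

/-- If `Re q ≥ 1 / 2` in the disk and `q 0 = 1`, then the fourth coefficient of `q` is at most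
one in modulus. -/
lemma norm_taylorCoeff_four_le_one {q : ℂ → ℂ} (hq : AnalyticOnNhd ℂ q unitDisk) (h0 : q 0 = 1)
    (hre : ∀ z ∈ unitDisk, 1 / 2 ≤ (q z).re) : ‖taylorCoeff q 4‖ ≤ 1 := by
  have hrot : ∀ c : ℂ, ‖c‖ = 1 → ∀ z ∈ unitDisk, c * z ∈ unitDisk := fun c hc z hz => by
    rw [mem_unitDisk] at hz ⊢; simpa [hc] using hz
  have han : ∀ c : ℂ, ‖c‖ = 1 → AnalyticOnNhd ℂ (fun z => q (c * z)) unitDisk :=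
    fun c hc z hz => (hq _ (hrot c hc z hz)).comp (analyticAt_const.mul analyticAt_id)
  have c₁ : ‖(1 : ℂ)‖ = 1 := by simp
  have c₂ : ‖Complex.I‖ = 1 := by simp
  have c₃ : ‖(-1 : ℂ)‖ = 1 := by simp
  have c₄ : ‖-Complex.I‖ = 1 := by simp
  -- Averaging over the fourth roots of unity keeps `Re ≥ 1/2` and kills the coefficients of orders
  -- 1, 2, 3, so `h = 1 + q₄ z⁴ + ⋯`.
  let h : ℂ → ℂ := fun z => (1 / 4 : ℂ) *
    ((q (1 * z) + q (Complex.I * z)) + (q (-1 * z) + q (-Complex.I * z)))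
  have hh : AnalyticOnNhd ℂ h unitDisk := fun z hz => analyticAt_const.mul
    (((han 1 c₁ z hz).add (han _ c₂ z hz)).add ((han _ c₃ z hz).add (han _ c₄ z hz)))
  have hcoeff : ∀ n, taylorCoeff h n = (1 / 4 : ℂ) *
      (1 + Complex.I ^ n + (-1) ^ n + (-Complex.I) ^ n) * taylorCoeff q n := fun n => by
    have z₁ := han 1 c₁ 0 zero_mem_unitDisk
    have z₂ := han _ c₂ 0 zero_mem_unitDisk
    have z₃ := han _ c₃ 0 zero_mem_unitDisk
    have z₄ := han _ c₄ 0 zero_mem_unitDisk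
    rw [← coeff_taylorSeriesAtZero, show taylorSeriesAtZero h = _ from
      taylorSeriesAtZero_const_mul _ ((z₁.fun_add z₂).fun_add (z₃.fun_add z₄)),
      taylorSeriesAtZero_add (z₁.fun_add z₂) (z₃.fun_add z₄), taylorSeriesAtZero_add z₁ z₂,
      taylorSeriesAtZero_add z₃ z₄, PowerSeries.coeff_C_mul]
    simp only [map_add, coeff_taylorSeriesAtZero, taylorCoeff_comp_const_mul hq c₁,
      taylorCoeff_comp_const_mul hq c₂, taylorCoeff_comp_const_mul hq c₃,
      taylorCoeff_comp_const_mul hq c₄]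
    ring
  have hhre : ∀ z ∈ unitDisk, 1 / 2 ≤ (h z).re := fun z hz => by
    have e₁ := hre _ (hrot 1 c₁ z hz)
    have e₂ := hre _ (hrot _ c₂ z hz)
    have e₃ := hre _ (hrot _ c₃ z hz)
    have e₄ := hre _ (hrot _ c₄ z hz)
    have : (h z).re = 1 / 4 * (((q (1 * z)).re + (q (Complex.I * z)).re) +
        ((q (-1 * z)).re + (q (-Complex.I * z)).re)) := by
      simp only [h]
      rw [show (1 / 4 : ℂ) = ((1 / 4 : ℝ) : ℂ) by norm_num, Complex.re_ofReal_mul]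
      simp only [Complex.add_re]
    rw [this]
    linarith
  have hne : ∀ z ∈ unitDisk, h z ≠ 0 := fun z hz h' => by
    have := hhre z hz
    rw [h'] at this
    norm_num at this
  -- `Re h ≥ 1/2` says precisely that `|h - 1| ≤ |h|`; the quotient `(h - 1) / h` begins with `q₄
  -- z⁴`, so its fourth coefficient is `q₄`.
  have hΩ : AnalyticOnNhd ℂ (fun z => (h z - 1) / h z) unitDisk :=
    fun z hz => ((hh z hz).sub analyticAt_const).div (hh z hz) (hne z hz)
  have hΩb : ∀ z ∈ unitDisk, ‖(h z - 1) / h z‖ ≤ 1 := fun z hz => by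
    rw [norm_div, div_le_one (norm_pos_iff.2 (hne z hz))]
    refine abs_le_of_sq_le_sq' ?_ (norm_nonneg _) |>.2
    rw [← Complex.normSq_eq_norm_sq, ← Complex.normSq_eq_norm_sq, Complex.normSq_apply,
      Complex.normSq_apply]
    simp only [Complex.sub_re, Complex.sub_im, Complex.one_re, Complex.one_im]
    linarith [hhre z hz]
  have hT : taylorSeriesAtZero (fun z => (h z - 1) / h z) * taylorSeriesAtZero h +
      PowerSeries.C 1 = taylorSeriesAtZero h := by
    have hΩ0 := hΩ 0 zero_mem_unitDisk
    have hh0 := hh 0 zero_mem_unitDisk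
    rw [← taylorSeriesAtZero_const, ← taylorSeriesAtZero_mul hΩ0 hh0,
      ← taylorSeriesAtZero_add (hΩ0.fun_mul hh0) analyticAt_const]
    refine taylorSeriesAtZero_congr_on fun z hz => ?_
    have := hne z hz
    field_simp
    ring
  have hq0 : taylorCoeff q 0 = 1 := by simp [taylorCoeff, h0]
  have d0 : taylorCoeff h 0 = 1 := by rw [hcoeff, hq0]; norm_num
  have d1 : taylorCoeff h 1 = 0 := by rw [hcoeff]; ring
  have d2 : taylorCoeff h 2 = 0 := by
    rw [hcoeff]; linear_combination taylorCoeff q 2 / 2 * Complex.I_sq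
  have d3 : taylorCoeff h 3 = 0 := by rw [hcoeff]; ring
  have d4 : taylorCoeff h 4 = taylorCoeff q 4 := by
    rw [hcoeff]; linear_combination taylorCoeff q 4 / 2 * Complex.I_pow_four
  have hc : ∀ n, PowerSeries.coeff n (taylorSeriesAtZero (fun z => (h z - 1) / h z) *
      taylorSeriesAtZero h + PowerSeries.C 1) = taylorCoeff h n := fun n => by
    rw [hT, coeff_taylorSeriesAtZero]
  have t0 := hc 0
  have t4 := hc 4
  simp only [map_add, coeff_mul_eq_sum_range, Finset.sum_range_succ, Finset.sum_range_zero,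
    PowerSeries.coeff_C, coeff_taylorSeriesAtZero, Nat.reduceSub, d0, d1, d2, d3, d4,
    if_true] at t0 t4
  norm_num at t0 t4
  rw [t0, zero_mul, zero_add] at t4
  rw [← t4]
  exact norm_taylorCoeff_le_one hΩ hΩb 4

/-! ### Coefficient identities for formal power series -/

open PowerSeries in
/-- The fifth coefficient of `X / ((1 - X P) (1 - l X P))` through the coefficients of
`Q = 1 / (1 - X P)`. -/
lemma coeff_five_eq {F P Q : PowerSeries ℂ} {l : ℂ}
    (hF : F * ((1 - X * P) * (1 - C l * (X * P))) = X) (hQ : Q * (1 - X * P) = 1) :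
    coeff 5 F = (1 + l) * coeff 4 Q + l ^ 2 * (2 * coeff 1 Q * coeff 3 Q + coeff 2 Q ^ 2 -
      3 * (1 - l) * coeff 1 Q ^ 2 * coeff 2 Q + (1 - l) ^ 2 * coeff 1 Q ^ 4) := by
  -- Comes from `1 - l X P = l (1 - X P) + (1 - l)`; being linear in `F`, it yields the coefficients
  -- of `F` recursively.
  have h : F * (C l + C (1 - l) * Q) = X * (Q * Q) := by
    rw [map_sub, map_one]
    linear_combination Q ^ 2 * hF - F * (Q * (1 - C l * (X * P)) + C l) * hQ
  have q0 : coeff 0 Q = 1 := by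
    have := congrArg (coeff 0) hQ
    simpa using this
  have hc := fun n => congrArg (coeff n) h
  have t0 := hc 0
  have t1 := hc 1
  have t2 := hc 2
  have t3 := hc 3
  have t4 := hc 4
  have t5 := hc 5
  simp only [coeff_mul_eq_sum_range, Finset.sum_range_succ, Finset.sum_range_zero, map_add,
    coeff_C, coeff_X, Nat.reduceSub, q0, if_true] at t0 t1 t2 t3 t4 t5
  norm_num at t0 t1 t2 t3 t4 t5
  simp only [t0, zero_mul, zero_add] at t1 t2 t3 t4 t5
  simp only [t1, one_mul] at t2 t3 t4 t5
  generalize coeff 1 Q = q₁ at *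
  generalize coeff 2 Q = q₂ at *
  generalize coeff 3 Q = q₃ at *
  generalize coeff 4 Q = q₄ at *
  have u2 : coeff 2 F = (1 + l) * q₁ := by linear_combination t2
  have u3 : coeff 3 F = 2 * q₂ + q₁ ^ 2 - (1 - l) * (q₂ + (1 + l) * q₁ * q₁) := by
    rw [u2] at t3; linear_combination t3
  have u4 : coeff 4 F = 2 * q₃ + 2 * q₁ * q₂ - (1 - l) * (q₃ + (1 + l) * q₁ * q₂ +
      (2 * q₂ + q₁ ^ 2 - (1 - l) * (q₂ + (1 + l) * q₁ * q₁)) * q₁) := by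
    rw [u2, u3] at t4; linear_combination t4
  rw [u2, u3, u4] at t5
  linear_combination t5

open PowerSeries in
/-- Coefficients of `1 / (1 - X P)` through Schur parameters. -/
lemma coeff_geom_of_schur {P P₁ P₂ Q : PowerSeries ℂ} {a a' b b' w : ℂ}
    (hP : P * (1 + C a' * (X * P₁)) = C a + X * P₁)
    (hP₁ : P₁ * (1 + C b' * (X * P₂)) = C b + X * P₂) (hw : coeff 0 P₂ = w)
    (hQ : Q * (1 - X * P) = 1) :
    coeff 1 Q = a ∧ coeff 2 Q = a ^ 2 + (1 - a * a') * b ∧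
      coeff 3 Q = a ^ 3 + 2 * a * (1 - a * a') * b +
        (1 - a * a') * (-a' * b ^ 2 + (1 - b * b') * w) := by
  have p0 := congrArg (coeff 0) hP
  have p1 := congrArg (coeff 1) hP
  have p2 := congrArg (coeff 2) hP
  have r0 := congrArg (coeff 0) hP₁
  have r1 := congrArg (coeff 1) hP₁
  have s0 := congrArg (coeff 0) hQ
  have s1 := congrArg (coeff 1) hQ
  have s2 := congrArg (coeff 2) hQ
  have s3 := congrArg (coeff 3) hQ
  simp only [coeff_mul_eq_sum_range, Finset.sum_range_succ, Finset.sum_range_zero, map_add, map_sub,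
    coeff_C, coeff_X, coeff_one, Nat.reduceSub, if_true, hw] at p0 p1 p2 r0 r1 s0 s1 s2 s3
  norm_num at p0 p1 p2 r0 r1 s0 s1 s2 s3
  subst p0 r0
  simp only [s0, one_mul] at s1 s2 s3
  generalize constantCoeff P = a at *
  generalize constantCoeff P₁ = b at *
  have e₁ : coeff 1 P = (1 - a * a') * b := by linear_combination p1
  have e₂ : coeff 1 P₁ = (1 - b * b') * w := by linear_combination r1
  have e₃ : coeff 2 P = (1 - a * a') * (-a' * b ^ 2 + (1 - b * b') * w) := by
    rw [e₁, e₂] at p2; linear_combination p2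
  have q₁ : coeff 1 Q = a := by linear_combination s1
  have q₂ : coeff 2 Q = a ^ 2 + (1 - a * a') * b := by
    rw [q₁, e₁] at s2; linear_combination s2
  refine ⟨q₁, q₂, ?_⟩
  rw [q₁, q₂, e₁, e₃] at s3
  linear_combination s3

/-! ### Assembling the coefficient bound -/

lemma one_half_le_re_inv_one_sub {u : ℂ} (hu : ‖u‖ < 1) : 1 / 2 ≤ ((1 - u)⁻¹).re := by
  have h1 : 0 < Complex.normSq (1 - u) := by
    rw [Complex.normSq_pos, sub_ne_zero]
    rintro rfl
    simp at hu
  have h2 : Complex.normSq u ≤ 1 := by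
    rw [Complex.normSq_eq_norm_sq]; nlinarith [norm_nonneg u]
  rw [Complex.inv_re, le_div_iff₀ h1]
  rw [Complex.normSq_apply] at h2 ⊢
  simp only [Complex.sub_re, Complex.sub_im, Complex.one_re, Complex.one_im]
  linarith

lemma taylorSeriesAtZero_one_sub_const_mul (c : ℂ) {g : ℂ → ℂ} (hg : AnalyticAt ℂ g 0) :
    taylorSeriesAtZero (fun z => 1 - c * (z * g z)) =
      1 - PowerSeries.C c * (PowerSeries.X * taylorSeriesAtZero g) := by
  have hzg : AnalyticAt ℂ (fun z => z * g z) 0 := analyticAt_id.fun_mul hg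
  have : (fun z => 1 - c * (z * g z)) = fun z => 1 + -c * (z * g z) := by ext z; ring
  rw [this, taylorSeriesAtZero_add analyticAt_const (analyticAt_const.fun_mul hzg),
    taylorSeriesAtZero_const_mul _ hzg, taylorSeriesAtZero_id_mul hg, taylorSeriesAtZero_const,
    map_one, map_neg]
  ring

/-- The power series form of a Schur step. -/
lemma taylorSeriesAtZero_schur_step {f g : ℂ → ℂ} {a a' : ℂ} (hf : AnalyticAt ℂ f 0)
    (hg : AnalyticAt ℂ g 0)
    (h : ∀ z ∈ unitDisk, f z * (1 + a' * (z * g z)) = a + z * g z) :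
    taylorSeriesAtZero f * (1 + PowerSeries.C a' * (PowerSeries.X * taylorSeriesAtZero g)) =
      PowerSeries.C a + PowerSeries.X * taylorSeriesAtZero g := by
  have hzg : AnalyticAt ℂ (fun z => z * g z) 0 := analyticAt_id.fun_mul hg
  have h' := taylorSeriesAtZero_congr_on h
  rwa [taylorSeriesAtZero_mul hf (analyticAt_const.fun_add (analyticAt_const.fun_mul hzg)),
    taylorSeriesAtZero_add analyticAt_const (analyticAt_const.fun_mul hzg),
    taylorSeriesAtZero_add analyticAt_const hzg, taylorSeriesAtZero_const_mul _ hzg,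
    taylorSeriesAtZero_id_mul hg, taylorSeriesAtZero_const, taylorSeriesAtZero_const,
    map_one] at h'

/-- The power series form of `f z = z / ((1 - z ψ z) (1 - c z ψ z))`. -/
lemma taylorSeriesAtZero_mul_eq_X {f ψ : ℂ → ℂ} {c : ℂ} (hf : AnalyticAt ℂ f 0)
    (hψ : AnalyticAt ℂ ψ 0)
    (h : ∀ z ∈ unitDisk, f z * ((1 - 1 * (z * ψ z)) * (1 - c * (z * ψ z))) = z) :
    taylorSeriesAtZero f * ((1 - PowerSeries.X * taylorSeriesAtZero ψ) *
      (1 - PowerSeries.C c * (PowerSeries.X * taylorSeriesAtZero ψ))) = PowerSeries.X := by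
  have han : ∀ d : ℂ, AnalyticAt ℂ (fun z => 1 - d * (z * ψ z)) 0 := fun d =>
    analyticAt_const.fun_sub (analyticAt_const.fun_mul (analyticAt_id.fun_mul hψ))
  have h' := taylorSeriesAtZero_congr_on h
  rwa [taylorSeriesAtZero_mul hf ((han 1).fun_mul (han c)), taylorSeriesAtZero_mul (han 1) (han c),
    taylorSeriesAtZero_one_sub_const_mul 1 hψ, taylorSeriesAtZero_one_sub_const_mul c hψ, map_one,
    one_mul, taylorSeriesAtZero_id] at h'

theorem norm_taylorCoeff_five_le {l : ℝ} {f : ℂ → ℂ} (hl : 2 / 5 ≤ l) (hl1 : l ≤ 1)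
    (hf : AnalyticOnNhd ℂ f unitDisk) (hf0 : f 0 = 0)
    (hsub : Subordinate (quotByZ f) (majorant l)) :
    ‖taylorCoeff f 5‖ ≤ 1 + l + l ^ 2 + l ^ 3 + l ^ 4 := by
  obtain ⟨ω, hω, hω0, hωb, hωf⟩ := hsub
  -- The sign turns `1 + ω` into `1 - z ψ`, so that the geometric series has positive coefficients.
  obtain ⟨ψ, hψ, hψb, hψω⟩ := exists_eq_mul_of_map_zero (f := fun z => -ω z)
    (fun z hz => (hω z hz).fun_neg) (by simp [hω0]) (fun z hz => by simpa using (hωb z hz).le)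
  obtain ⟨ψ₁, hψ₁, hψ₁b, hψ₁e⟩ := exists_schur_step hψ hψb
  obtain ⟨ψ₂, hψ₂, hψ₂b, hψ₂e⟩ := exists_schur_step hψ₁ hψ₁b
  have hu : ∀ z ∈ unitDisk, ‖z * ψ z‖ < 1 := fun z hz => by
    rw [← hψω z, norm_neg]; exact hωb z hz
  have hne : ∀ (c : ℂ), ‖c‖ ≤ 1 → ∀ z ∈ unitDisk, 1 - c * (z * ψ z) ≠ 0 := fun c hc z hz h => by
    have h2 : ‖c * (z * ψ z)‖ = 1 := by rw [← sub_eq_zero.1 h]; simp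
    rw [norm_mul] at h2
    nlinarith [hu z hz, norm_nonneg (z * ψ z), norm_nonneg c]
  have hlc : ‖(l : ℂ)‖ ≤ 1 := by
    rw [Complex.norm_real, Real.norm_of_nonneg (by linarith)]; exact hl1
  have hψ0 := hψ 0 zero_mem_unitDisk
  have hψ₁0 := hψ₁ 0 zero_mem_unitDisk
  have hψ₂0 := hψ₂ 0 zero_mem_unitDisk
  have hF := taylorSeriesAtZero_mul_eq_X (f := f) (c := l) (hf 0 zero_mem_unitDisk) hψ0
    fun z hz => by
      rcases eq_or_ne z 0 with rfl | hz0
      · simp [hf0]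
      have h₁ := hne 1 (by simp) z hz
      have h₂ := hne l hlc z hz
      have h := hωf z hz
      have hω' : ω z = -(z * ψ z) := by rw [← hψω z, neg_neg]
      rw [quotByZ, if_neg hz0, majorant, hω', show 1 + -(z * ψ z) = 1 - 1 * (z * ψ z) by ring,
        show 1 + (l : ℂ) * -(z * ψ z) = 1 - l * (z * ψ z) by ring,
        div_eq_div_iff hz0 (mul_ne_zero h₁ h₂)] at h
      rw [h, one_mul]
  have hden : AnalyticOnNhd ℂ (fun z => 1 - 1 * (z * ψ z)) unitDisk := fun z hz =>
    analyticAt_const.fun_sub (analyticAt_const.fun_mul (analyticAt_id.fun_mul (hψ z hz)))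
  have hq : AnalyticOnNhd ℂ (fun z => (1 - 1 * (z * ψ z))⁻¹) unitDisk := fun z hz =>
    (hden z hz).fun_inv (hne 1 (by simp) z hz)
  have hQ : taylorSeriesAtZero (fun z => (1 - 1 * (z * ψ z))⁻¹) *
      (1 - PowerSeries.X * taylorSeriesAtZero ψ) = 1 := by
    have h := taylorSeriesAtZero_one_sub_const_mul 1 hψ0
    rw [map_one, one_mul] at h
    rw [← h, ← taylorSeriesAtZero_mul (hq 0 zero_mem_unitDisk) (hden 0 zero_mem_unitDisk),
      ← map_one PowerSeries.C, ← taylorSeriesAtZero_const]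
    exact taylorSeriesAtZero_congr_on fun z hz => inv_mul_cancel₀ (hne 1 (by simp) z hz)
  have hq4 := norm_taylorCoeff_four_le_one hq (by simp) fun z hz => by
    simpa using one_half_le_re_inv_one_sub (hu z hz)
  obtain ⟨q₁, q₂, q₃⟩ := coeff_geom_of_schur (taylorSeriesAtZero_schur_step hψ0 hψ₁0 hψ₁e)
    (taylorSeriesAtZero_schur_step hψ₁0 hψ₂0 hψ₂e) (coeff_zero_taylorSeriesAtZero ψ₂) hQ
  have h5 := coeff_five_eq hF hQ
  rw [q₁, q₂, q₃, coeff_taylorSeriesAtZero, coeff_taylorSeriesAtZero, Complex.mul_conj',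
    Complex.mul_conj'] at h5
  have hE := norm_schurCombination_le hl hl1 (hψb 0 zero_mem_unitDisk) (hψ₁b 0 zero_mem_unitDisk)
    (hψ₂b 0 zero_mem_unitDisk)
  have hψc := Complex.mul_conj' (ψ 0)
  -- In the `b²` term, `q₂²` contributes `(1 - |a|²)²` and `2 q₁ q₃` contributes `-2 |a|² (1 -
  -- |a|²)`, whence the factor `1 - 3 |a|²`.
  have h5' : taylorCoeff f 5 = ((1 + l : ℝ) : ℂ) *
      taylorCoeff (fun z => (1 - 1 * (z * ψ z))⁻¹) 4 + ((l ^ 2 : ℝ) : ℂ) *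
      ((1 + l + l ^ 2) * ψ 0 ^ 4 + 3 * (1 + l) * ψ 0 ^ 2 * ((1 - ‖ψ 0‖ ^ 2) * ψ₁ 0) +
      (1 - ‖ψ 0‖ ^ 2) * (1 - 3 * ‖ψ 0‖ ^ 2) * ψ₁ 0 ^ 2 +
      2 * ψ 0 * (1 - ‖ψ 0‖ ^ 2) * (1 - ‖ψ₁ 0‖ ^ 2) * ψ₂ 0) := by
    rw [h5]
    push_cast
    linear_combination -2 * (l : ℂ) ^ 2 * (1 - ‖ψ 0‖ ^ 2) * ψ₁ 0 ^ 2 * hψc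
  rw [h5']
  refine (norm_add_le _ _).trans ?_
  rw [norm_mul, norm_mul, Complex.norm_real, Complex.norm_real,
    Real.norm_of_nonneg (by linarith), Real.norm_of_nonneg (sq_nonneg l)]
  calc _ ≤ (1 + l) * 1 + l ^ 2 * (1 + l + l ^ 2) := by gcongr
    _ = _ := by ring

/-! ### The quartic and its positive root -/

lemma quartic_lt_of_lt {x y : ℝ} (hx : 0 < x) (hxy : x < y) :
    9 * x ^ 4 - 3 * x ^ 3 + x ^ 2 + 2 * x - 1 < 9 * y ^ 4 - 3 * y ^ 3 + y ^ 2 + 2 * y - 1 := by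
  have hy : 0 < y := hx.trans hxy
  -- The difference quotient of the quartic between `x` and `y`.
  have h : 0 < 9 * (x ^ 2 + y ^ 2) * (x + y) - 3 * (x ^ 2 + x * y + y ^ 2) + (x + y) + 2 := by
    nlinarith [mul_nonneg (sq_nonneg (3 * (x + y) - 1)) (by linarith : 0 ≤ x + y),
      mul_nonneg (sq_nonneg (x - y)) (by linarith : 0 ≤ x + y), sq_nonneg (x - y),
      sq_nonneg (x + y), mul_pos hx hy]
  nlinarith [mul_pos (sub_pos.2 hxy) h]

lemma exists_quartic_root : ∃ x : ℝ, (0.400436 : ℝ) ≤ x ∧ x < 0.400437 ∧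
    9 * x ^ 4 - 3 * x ^ 3 + x ^ 2 + 2 * x - 1 = 0 := by
  have hc : ContinuousOn (fun x : ℝ => 9 * x ^ 4 - 3 * x ^ 3 + x ^ 2 + 2 * x - 1)
      (Set.Icc 0.400436 0.400437) := by fun_prop
  obtain ⟨x, hx, hx0⟩ := intermediate_value_Icc (by norm_num) hc
    (show (0 : ℝ) ∈ Set.Icc _ _ from ⟨by norm_num, by norm_num⟩)
  refine ⟨x, hx.1, lt_of_le_of_ne hx.2 ?_, hx0⟩
  rintro rfl
  norm_num at hx0

/-! ### Sharpness -/

section Extremal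

variable {l : ℝ} {z : ℂ}

lemma one_sub_mul_ne_zero {c : ℂ} (hc : ‖c‖ ≤ 1) (hz : z ∈ unitDisk) : 1 - c * z ≠ 0 := by
  intro h
  have h2 : ‖c * z‖ = 1 := by rw [← sub_eq_zero.1 h]; simp
  rw [norm_mul] at h2
  nlinarith [mem_unitDisk.1 hz, norm_nonneg z, norm_nonneg c]

lemma extremalFn_den_ne_zero (hl0 : 0 ≤ l) (hl1 : l ≤ 1) (hz : z ∈ unitDisk) :
    (1 - z) * (1 - (l : ℂ) * z) ≠ 0 := by
  refine mul_ne_zero (by simpa using one_sub_mul_ne_zero (c := 1) (by simp) hz)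
    (one_sub_mul_ne_zero ?_ hz)
  rw [Complex.norm_real, Real.norm_of_nonneg hl0]
  exact hl1

lemma hasDerivAt_extremalFn (hl0 : 0 ≤ l) (hl1 : l ≤ 1) (hz : z ∈ unitDisk) :
    HasDerivAt (extremalFn l) ((1 - l * z ^ 2) / ((1 - z) * (1 - (l : ℂ) * z)) ^ 2) z := by
  have h₁ : HasDerivAt (fun w : ℂ => 1 - w) (-1) z := by
    simpa using (hasDerivAt_id z).const_sub 1
  have h₂ : HasDerivAt (fun w : ℂ => 1 - (l : ℂ) * w) (-(l : ℂ)) z := by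
    simpa using ((hasDerivAt_id z).const_mul (l : ℂ)).const_sub 1
  have h : HasDerivAt (extremalFn l) _ z :=
    (hasDerivAt_id' z).fun_div (h₁.fun_mul h₂) (extremalFn_den_ne_zero hl0 hl1 hz)
  exact h.congr_deriv (by ring)

lemma quotByZ_extremalFn (hl0 : 0 ≤ l) (hl1 : l ≤ 1) (hz : z ∈ unitDisk) :
    quotByZ (extremalFn l) z = 1 / ((1 - z) * (1 - (l : ℂ) * z)) := by
  unfold quotByZ
  split_ifs with h
  · subst h
    rw [(hasDerivAt_extremalFn hl0 hl1 zero_mem_unitDisk).deriv]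
    simp
  · rw [extremalFn, div_right_comm, div_self h]

lemma uExpr_extremalFn (hl0 : 0 ≤ l) (hl1 : l ≤ 1) (hz : z ∈ unitDisk) :
    uExpr (extremalFn l) z = -(l : ℂ) * z ^ 2 := by
  have h := extremalFn_den_ne_zero hl0 hl1 hz
  rw [uExpr, quotByZ_extremalFn hl0 hl1 hz, (hasDerivAt_extremalFn hl0 hl1 hz).deriv, one_div,
    inv_inv, mul_div_cancel₀ _ (pow_ne_zero 2 h)]
  ring

lemma analyticOnNhd_extremalFn (hl0 : 0 ≤ l) (hl1 : l ≤ 1) :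
    AnalyticOnNhd ℂ (extremalFn l) unitDisk :=
  analyticOnNhd_unitDisk_iff.2 fun _ hz =>
    (hasDerivAt_extremalFn hl0 hl1 hz).differentiableAt.differentiableWithinAt

lemma classU_extremalFn (hl0 : 0 < l) (hl1 : l ≤ 1) : ClassU l (extremalFn l) where
  normalized :=
    { analytic := analyticOnNhd_extremalFn hl0.le hl1
      map_zero := by simp [extremalFn]
      deriv_zero := by
        rw [(hasDerivAt_extremalFn hl0.le hl1 zero_mem_unitDisk).deriv]; simp }
  ne_zero _ hz hz0 := div_ne_zero hz0 (extremalFn_den_ne_zero hl0.le hl1 hz)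
  bound z hz := by
    rw [uExpr_extremalFn hl0.le hl1 hz, norm_mul, norm_neg, norm_pow, Complex.norm_real,
      Real.norm_of_nonneg hl0.le]
    have : ‖z‖ ^ 2 < 1 := pow_lt_one₀ (norm_nonneg z) (mem_unitDisk.1 hz) two_ne_zero
    exact mul_lt_of_lt_one_right hl0 this

lemma subordinate_extremalFn (hl0 : 0 ≤ l) (hl1 : l ≤ 1) :
    Subordinate (quotByZ (extremalFn l)) (majorant l) := by
  refine ⟨fun z => -z, fun z _ => analyticAt_id.fun_neg, neg_zero, fun z hz => ?_, fun z hz => ?_⟩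
  · rw [norm_neg]; exact mem_unitDisk.1 hz
  · rw [quotByZ_extremalFn hl0 hl1 hz, majorant, mul_neg, ← sub_eq_add_neg, ← sub_eq_add_neg]

/-- The case `ψ = 1` of the general coefficient formula: `Q` is the geometric series, so every `qₙ`
equals `1`. -/
lemma taylorCoeff_five_extremalFn (hl0 : 0 ≤ l) (hl1 : l ≤ 1) :
    taylorCoeff (extremalFn l) 5 = 1 + l + l ^ 2 + l ^ 3 + l ^ 4 := by
  have hF := taylorSeriesAtZero_mul_eq_X (f := extremalFn l) (ψ := fun _ => 1) (c := l)
    (analyticOnNhd_extremalFn hl0 hl1 0 zero_mem_unitDisk) analyticAt_const fun z hz => by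
      rw [mul_one, one_mul, extremalFn, div_mul_cancel₀ _ (extremalFn_den_ne_zero hl0 hl1 hz)]
  have hQ : (PowerSeries.mk 1 : PowerSeries ℂ) *
      (1 - PowerSeries.X * taylorSeriesAtZero (fun _ => 1)) = 1 := by
    rw [taylorSeriesAtZero_const, map_one, mul_one]
    exact PowerSeries.mk_one_mul_one_sub_eq_one ℂ
  have h := coeff_five_eq hF hQ
  simp only [coeff_taylorSeriesAtZero, PowerSeries.coeff_mk, Pi.one_apply] at h
  rw [h]
  ring

lemma norm_taylorCoeff_five_extremalFn (hl0 : 0 ≤ l) (hl1 : l ≤ 1) :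
    ‖taylorCoeff (extremalFn l) 5‖ = 1 + l + l ^ 2 + l ^ 3 + l ^ 4 := by
  rw [taylorCoeff_five_extremalFn hl0 hl1]
  have : (1 + l + l ^ 2 + l ^ 3 + l ^ 4 : ℂ) = ((1 + l + l ^ 2 + l ^ 3 + l ^ 4 : ℝ) : ℂ) := by
    push_cast; ring
  rw [this, Complex.norm_real, Real.norm_of_nonneg (by positivity)]

end Extremal

theorem mainTheorem1 :
    ∃ lam₀ : ℝ,
      -- `lam₀ = 0.400436…` is the unique positive root
      (0 < lam₀ ∧ 9 * lam₀ ^ 4 - 3 * lam₀ ^ 3 + lam₀ ^ 2 + 2 * lam₀ - 1 = 0) ∧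
      (∀ x : ℝ, 0 < x → 9 * x ^ 4 - 3 * x ^ 3 + x ^ 2 + 2 * x - 1 = 0 → x = lam₀) ∧
      ((0.400436 : ℝ) ≤ lam₀ ∧ lam₀ < (0.400437 : ℝ)) ∧
      ∀ lam : ℝ, lam₀ ≤ lam → lam ≤ 1 →
        -- the coefficient bound
        (∀ f : ℂ → ℂ, ClassU lam f → Subordinate (quotByZ f) (majorant lam) →
          ‖taylorCoeff f 5‖ ≤ 1 + lam + lam ^ 2 + lam ^ 3 + lam ^ 4) ∧
        -- sharpness: the bound is attained within the class by `extremalFn lam`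
        (ClassU lam (extremalFn lam) ∧
          Subordinate (quotByZ (extremalFn lam)) (majorant lam) ∧
          (∀ z ∈ unitDisk, uExpr (extremalFn lam) z = -(lam : ℂ) * z ^ 2) ∧
          ‖taylorCoeff (extremalFn lam) 5‖ = 1 + lam + lam ^ 2 + lam ^ 3 + lam ^ 4) := by
  obtain ⟨lam₀, h₁, h₂, hroot⟩ := exists_quartic_root
  have hpos : 0 < lam₀ := lt_of_lt_of_le (by norm_num) h₁
  refine ⟨lam₀, ⟨hpos, hroot⟩, fun x hx hx0 => ?_, ⟨h₁, h₂⟩, fun lam hlam hlam1 => ?_⟩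
  · rcases lt_trichotomy x lam₀ with h | h | h
    · linarith [quartic_lt_of_lt hx h]
    · exact h
    · linarith [quartic_lt_of_lt hpos h]
  have hl : 2 / 5 ≤ lam := le_trans (by norm_num) (h₁.trans hlam)
  have hl0 : 0 < lam := by linarith
  exact ⟨fun f hf hsub => norm_taylorCoeff_five_le hl hlam1 hf.normalized.analytic
      hf.normalized.map_zero hsub,
    classU_extremalFn hl0 hlam1, subordinate_extremalFn hl0.le hlam1,
    fun z hz => uExpr_extremalFn hl0.le hlam1 hz, norm_taylorCoeff_five_extremalFn hl0.le hlam1⟩
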